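/- **Setting.** A (general) logic program $P$ is a finite list of clauses $A\leftarrow L_1,\dots,L_n$ ($A$ an atom, each $L_i$ an atom or a negated atom). A query $Q_0=p(\dots)$ is a single atom each of whose arguments is a term or an input mode; it is concrete if it has no input mode, and moded otherwise. A repetition number is an integer $r\ge 2$. The moded generalized SLDNF-tree $MT_{Q_0}$ has as its root the goal obtained from $Q_0$ by replacing the input modes by distinct new variables, called input variables. It is built depth-first, always selecting the left-most subgoal, and trying the clauses of $P$ in their given order. A selected atom is resolved with a renamed-apart copy of a clause by a most general unifier $\theta$ which never replaces a variable of the subgoal by a variable of the clause and never replaces an input variable by a variable that is not an input variable; if an input variable is substituted by $f(\dots)$, all variables of $f(\dots)$ become input variables. For a selected ground literal $\neg A$ a subsidiary tree for $\leftarrow A$ is built, connected by a negation arc; it is abandoned at its first success leaf, in which case the branch with $\neg A$ fails. If it is completed without a success leaf, the branch continues with the remaining subgoals. (A node whose selected literal is negative and non-ground is a leaf; such floundering does not occur for the queries usually considered.) A derivation is a path $N_0:G_0\Rightarrow N_1:G_1\Rightarrow\cdots$ from the root, possibly across negation arcs. When a subgoal $L$ selected at a node is resolved, $L$ and its ancestors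 are the ancestors of the new subgoals; $A$ inherits the ancestors of $\neg A$ across a negation arc. The symbol string of an atom is the left-to-right sequence of its predicate, function, constant and variable symbols, with every variable replaced by one symbol $\mathcal X$. The goal $G_j$ is a loop goal of $G_i$ if their selected subgoals $A_j$, $A_i$ are atoms with the same predicate symbol, $A_i$ (at $N_i$) is an ancestor of $A_j$ (at $N_j$), and the symbol string of $A_i$ results from that of $A_j$ by deleting zero or more symbols. **Procedure TPoLP$(P,Q_0,r)$.** Set $L=0$ and construct $MT_{Q_0}$ as above. Whenever a prefix $$N_0:G_0\Rightarrow\cdots N_{g_1}:G_{g_1}\Rightarrow_{C}\cdots N_{g_2}:G_{g_2}\Rightarrow_{C}\cdots N_{g_r}:G_{g_r}\Rightarrow_{C}$$ is produced in which the same clause $C$ is applied at all $N_{g_j}$ and $G_{g_{j+1}}$ is a loop goal of $G_{g_j}$ for all $1\le j<r$: if for some $0<i<r$ there is no substitution $X/f(\dots Y\dots)$ made between $N_{g_i}$ and $N_{g_{i+1}}$ with $X$ an input variable and $Y$ a variable of the selected subgoal of $G_{g_{i+1}}$, return *predicted-non-terminating*; otherwise set $L=1$ and go on from $N_{g_r}$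 with the clause $C$ skipped. When the construction is complete, return *terminating* if $L=0$ and *predicted-terminating* if $L=1$. **Proposition.** For every logic program $P$, every concrete or moded query $Q_0$ and every repetition number $r\ge 2$, the procedure TPoLP$(P,Q_0,r)$ terminates: whatever variable names and most general unifiers (as above) are chosen, it has no infinite run, and a run can only end by returning one of the three answers. -/

import Mathlib

namespace LogicProg

universe u v

/-! ### Syntax

Function symbols (constants are the `0`-ary ones) and predicate symbols are those of a
first-order language `L`; terms are Mathlib's first-order terms over variables named by `ℕ`. -/

abbrev Tm (L : FirstOrder.Language.{u, v}) : Type u := L.Term ℕ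

abbrev Subst (L : FirstOrder.Language.{u, v}) : Type u := ℕ → Tm L

/-- An atom `p(T₁, …, Tₙ)`. -/
structure Atom (L : FirstOrder.Language.{u, v}) where
  arity : ℕ
  pred : L.Relations arity
  args : Fin arity → Tm L

variable {L : FirstOrder.Language.{u, v}}

def Atom.vars (A : Atom L) : Finset ℕ :=
  Finset.univ.biUnion fun i => (A.args i).varFinset

def Atom.subst (A : Atom L) (θ : Subst L) : Atom L :=
  ⟨A.arity, A.pred, fun i => (A.args i).subst θ⟩

/-- A literal: an atom or its negation. -/
inductive Literal (L : FirstOrder.Language.{u, v}) where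
  | pos (A : Atom L)
  | neg (A : Atom L)

def Literal.atom : Literal L → Atom L
  | .pos A => A
  | .neg A => A

def Literal.subst (l : Literal L) (θ : Subst L) : Literal L :=
  match l with
  | .pos A => .pos (A.subst θ)
  | .neg A => .neg (A.subst θ)

/-- A program clause `A ← L₁, …, Lₙ`. -/
structure Clause (L : FirstOrder.Language.{u, v}) where
  head : Atom L
  body : List (Literal L)

def Clause.vars (C : Clause L) : Finset ℕ :=
  C.head.vars ∪ (C.body.map fun l => l.atom.vars).foldr (· ∪ ·) ∅

/-- The variant of a clause obtained by renaming its variables along `ρ`. -/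
def Clause.rename (C : Clause L) (ρ : ℕ → ℕ) : Clause L :=
  ⟨C.head.subst fun x => .var (ρ x), C.body.map fun l => l.subst fun x => .var (ρ x)⟩

/-- A general logic program: finitely many clauses, listed in the textual order in which the
depth-first strategy tries them. -/
abbrev Program (L : FirstOrder.Language.{u, v}) := List (Clause L)

/-- An argument of a query: an input mode, or an ordinary term. -/
inductive QueryArg (L : FirstOrder.Language.{u, v}) where
  | inputMode
  | term (t : Tm L)

/-- A query is a single atom, some of whose arguments may be input modes. It is concrete if no
argument is an input mode, and moded otherwise. -/
structure Query (L : FirstOrder.Language.{u, v}) where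
  arity : ℕ
  pred : L.Relations arity
  args : Fin arity → QueryArg L

/-! ### Most general unifiers -/

def Unifies (σ : Subst L) (A B : Atom L) : Prop := A.subst σ = B.subst σ

/-- `θ` is an idempotent most general unifier of `A` and `B`, acting only on variables of `A`
and `B` and introducing no other variables. -/
structure IsMgu (θ : Subst L) (A B : Atom L) : Prop where
  unifies : Unifies θ A B
  general : ∀ σ : Subst L, Unifies σ A B → ∃ τ : Subst L, ∀ x, σ x = (θ x).subst τ
  idem : ∀ x, (θ x).subst θ = θ x
  outside : ∀ x, x ∉ A.vars ∪ B.vars → θ x = .var x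
  inside : ∀ x, x ∈ A.vars ∪ B.vars → (θ x).varFinset ⊆ A.vars ∪ B.vars

/-- `θ` is an mgu of the selected subgoal `A` and the clause head `H` obeying the conventions
for variable-variable substitutions: a variable of the subgoal is never replaced by a variable
of the clause, and a variable in the set `I` of input variables is never replaced by a variable
outside `I`. -/
structure IsResolutionMgu (I : Set ℕ) (θ : Subst L) (A H : Atom L) : Prop where
  mgu : IsMgu θ A H
  goal_var : ∀ x y, θ x = .var y → x ∈ A.vars → y ∈ A.vars
  input_var : ∀ x y, θ x = .var y → x ∈ I → y ∈ I

/-- `θ` contains a substitution `X/f(… Y …)`. -/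
def BindsToFunction (θ : Subst L) (X Y : ℕ) : Prop :=
  (∃ (n : ℕ) (f : L.Functions n) (ts : Fin n → Tm L), θ X = .func f ts) ∧
    Y ∈ (θ X).varFinset

/-! ### Symbol strings and loops -/

/-- The symbols of symbol strings. -/
inductive Sym (L : FirstOrder.Language.{u, v}) where
  | pred {n : ℕ} (p : L.Relations n)
  | func {n : ℕ} (f : L.Functions n)
  | X

/-- The symbol string of a term: its symbols from left to right, every variable replaced by the
one symbol `X`. -/
def symbolString (t : Tm L) : List (Sym L) :=
  t.listEncode.map fun
    | .inl _ => Sym.X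
    | .inr f => Sym.func f.2

def Atom.symbolString (A : Atom L) : List (Sym L) :=
  Sym.pred A.pred :: (List.ofFn fun i => LogicProg.symbolString (A.args i)).flatten

/-- `A₁` loops into `A₂`: they have the same predicate symbol, and the symbol string of `A₁` is
obtained from that of `A₂` by removing zero or more elements. -/
def LoopsInto (A₁ A₂ : Atom L) : Prop :=
  (⟨A₁.arity, A₁.pred⟩ : Σ n, L.Relations n) = ⟨A₂.arity, A₂.pred⟩ ∧
    A₁.symbolString.Sublist A₂.symbolString

/-! ### Generalized SLDNF-derivations -/

/-- An occurrence of a literal in a goal, with its ancestors. An ancestor is the selected subgoal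
of an earlier node of the derivation, and it is recorded by the position of that node. -/
structure Subgoal (L : FirstOrder.Language.{u, v}) where
  lit : Literal L
  anc : Finset ℕ

def Subgoal.subst (s : Subgoal L) (θ : Subst L) : Subgoal L := ⟨s.lit.subst θ, s.anc⟩

/-- A node: its goal (the selected subgoal is the first one), the input variables, and the
variables that have occurred so far in the derivation. -/
structure Node (L : FirstOrder.Language.{u, v}) where
  goal : List (Subgoal L)
  inputVars : Set ℕ
  usedVars : Finset ℕ

/-- The edge leaving a node: application of a program clause with an mgu, a negation arc into
the subsidiary tree of the selected subgoal `¬A`, or the removal of a selected `¬A` whose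
subsidiary tree has no success leaf. -/
inductive Edge (L : FirstOrder.Language.{u, v}) where
  | clause (C : Clause L) (θ : Subst L)
  | negArc
  | negSolved

/-- A finite generalized SLDNF-derivation `N₀ ⇒ N₁ ⇒ … ⇒ Nₖ`: the list `past` of the nodes
`N₀, …, Nₖ₋₁`, each with the edge leaving it, and the last node `Nₖ`. -/
structure Derivation (L : FirstOrder.Language.{u, v}) where
  past : List (Node L × Edge L)
  last : Node L

namespace Derivation

/-- The node at position `i`. -/
def node? (D : Derivation L) (i : ℕ) : Option (Node L) :=
  (D.past.map Prod.fst ++ [D.last])[i]?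

/-- `D` extended along the edge `e` to the node `N`. -/
def extend (D : Derivation L) (e : Edge L) (N : Node L) : Derivation L :=
  ⟨D.past ++ [(D.last, e)], N⟩

/-- The selected subgoal at position `i` is the positive literal `A` with ancestors `anc`. -/
def Selects (D : Derivation L) (i : ℕ) (A : Atom L) (anc : Finset ℕ) : Prop :=
  ∃ N rest, D.node? i = some N ∧ N.goal = ⟨.pos A, anc⟩ :: rest

/-- The goal at position `j` is a loop goal of the goal at position `i`. -/
def IsLoopGoal (D : Derivation L) (i j : ℕ) : Prop :=
  ∃ Aᵢ ancᵢ Aⱼ ancⱼ, D.Selects i Aᵢ ancᵢ ∧ D.Selects j Aⱼ ancⱼ ∧ i ∈ ancⱼ ∧ LoopsInto Aᵢ Aⱼ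

/-- At position `i` the program clause `C` has been applied. -/
def Applied (D : Derivation L) (i : ℕ) (C : Clause L) : Prop :=
  ∃ N θ, D.past[i]? = some (N, .clause C θ)

/-- The derivation `D`, continued by an application of `C` at its last node, has the form
`N₀ ⇒ … N_{g 1} ⇒_C … N_{g 2} ⇒_C … N_{g r} ⇒_C`, where `N_{g r}` is the last node of `D` and
the goal at `g (j+1)` is a loop goal of the goal at `g j`. -/
structure IsLoopPrefix (r : ℕ) (D : Derivation L) (C : Clause L) (g : ℕ → ℕ) : Prop where
  lt : ∀ j, 1 ≤ j → j < r → g j < g (j + 1)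
  last : g r = D.past.length
  loop : ∀ j, 1 ≤ j → j < r → D.IsLoopGoal (g j) (g (j + 1))
  same : ∀ j, 1 ≤ j → j < r → D.Applied (g j) C

/-- The term-size decrease property of such a prefix: between `N_{g i}` and `N_{g (i+1)}` there
is a substitution `X/f(… Y …)` where `X` is an input variable and `Y` appears in the selected
subgoal at `g (i+1)`. -/
def TermSizeDecrease (r : ℕ) (D : Derivation L) (g : ℕ → ℕ) : Prop :=
  ∀ i, 0 < i → i < r → ∃ k, g i ≤ k ∧ k < g (i + 1) ∧
    ∃ N C θ X Y A anc, D.past[k]? = some (N, .clause C θ) ∧ X ∈ N.inputVars ∧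
      BindsToFunction θ X Y ∧ D.Selects (g (i + 1)) A anc ∧ Y ∈ A.vars

/-- `ρ` renames the clause `C` apart from all variables that have occurred in `D`. -/
def RenamesApart (D : Derivation L) (C : Clause L) (ρ : ℕ → ℕ) : Prop :=
  Function.Injective ρ ∧ Disjoint (C.rename ρ).vars D.last.usedVars

/-- The clause `C` can be applied to the selected atom `A` at the last node of `D`: a copy of `C`
renamed apart has a head that unifies with `A`. -/
def Applicable (D : Derivation L) (A : Atom L) (C : Clause L) : Prop :=
  ∃ ρ, D.RenamesApart C ρ ∧ ∃ σ, Unifies σ A (C.rename ρ).head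

/-- The extension of `D` by resolving the selected subgoal `s` of the goal `s, rest` with the
copy `C.rename ρ` of `C` by means of `θ`. The new subgoals have `s` and its ancestors as their
ancestors. If an input variable is substituted by a function, the variables of the latter
become input variables. -/
def resolve (D : Derivation L) (s : Subgoal L) (rest : List (Subgoal L)) (C : Clause L)
    (ρ : ℕ → ℕ) (θ : Subst L) : Derivation L :=
  D.extend (.clause C θ)
    { goal := ((C.rename ρ).body.map fun l => ⟨l.subst θ, insert D.past.length s.anc⟩) ++
        rest.map fun t => t.subst θ
      inputVars := D.last.inputVars ∪ {Y | ∃ X ∈ D.last.inputVars, BindsToFunction θ X Y}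
      usedVars := D.last.usedVars ∪ (C.rename ρ).vars }

/-- The extension of `D` along a negation arc to the root `← A` of the subsidiary tree for a
selected ground subgoal `¬A`; `A` inherits the ancestors `anc` of `¬A`. -/
def enterNeg (D : Derivation L) (A : Atom L) (anc : Finset ℕ) : Derivation L :=
  D.extend .negArc { D.last with goal := [⟨.pos A, anc⟩] }

/-- The extension of `D` by dropping the selected negative subgoal. -/
def solveNeg (D : Derivation L) : Derivation L :=
  D.extend .negSolved { D.last with goal := D.last.goal.tail }

end Derivation

/-- The root of the moded generalized SLDNF-tree of `Q`, the input mode at argument `i` being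
replaced by the variable `v i`. -/
def Query.rootAtom (Q : Query L) (v : Fin Q.arity → ℕ) : Atom L :=
  ⟨Q.arity, Q.pred, fun i =>
    match Q.args i with
    | .inputMode => .var (v i)
    | .term t => t⟩

def Query.root (Q : Query L) (v : Fin Q.arity → ℕ) : Derivation L :=
  ⟨[], { goal := [⟨.pos (Q.rootAtom v), ∅⟩]
         inputVars := {x | ∃ i, Q.args i = .inputMode ∧ v i = x}
         usedVars := (Q.rootAtom v).vars }⟩

/-! ### The procedure TPoLP -/

inductive Answer where
  | terminating
  | predictedTerminating
  | predictedNonTerminating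

/-- An entry of the depth-first stack: a node (given with the derivation leading to it) and the
clauses still to be tried there, or a node whose selected negative subgoal waits for its
subsidiary tree, which is being built by the entries above it. -/
inductive Frame (L : FirstOrder.Language.{u, v}) where
  | expand (D : Derivation L) (todo : List (Clause L))
  | await (D : Derivation L)

def Frame.isAwait : Frame L → Bool
  | .expand _ _ => false
  | .await _ => true

/-- The stack after a success leaf. If the leaf lies in a subsidiary tree, that tree is closed and
the negative subgoal waiting for it fails. In the main tree, the construction just goes on. -/
def afterSuccess (S : List (Frame L)) : List (Frame L) :=
  match S.dropWhile fun F => !F.isAwait with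
  | [] => S
  | _ :: S' => S'

inductive State (L : FirstOrder.Language.{u, v}) where
  | start
  | run (flag : Bool) (stack : List (Frame L))
  | halt (a : Answer)

/-- One step of TPoLP(`P`, `Q`, `r`). The only nondeterminism is in the names of the input
variables and of the renamed clause variables and in the choice of the mgu. -/
inductive Step (P : Program L) (Q : Query L) (r : ℕ) : State L → State L → Prop
  /-- Set the flag to `0` and create the root, with distinct new variables for the input modes. -/
  | init (v : Fin Q.arity → ℕ)
      (distinct : Set.InjOn v {i | Q.args i = .inputMode})
      (new : ∀ i j t, Q.args i = .inputMode → Q.args j = .term t → v i ∉ t.varFinset) :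
      Step P Q r .start (.run false [.expand (Q.root v) P])
  /-- The tree is complete. -/
  | finish (flag : Bool) :
      Step P Q r (.run flag [])
        (.halt (if flag then .predictedTerminating else .terminating))
  /-- The empty goal is a success leaf. -/
  | success (flag : Bool) (D : Derivation L) (todo : List (Clause L)) (S : List (Frame L))
      (sel : D.last.goal = []) :
      Step P Q r (.run flag (.expand D todo :: S)) (.run flag (afterSuccess S))
  /-- All clauses have been tried at the node. -/
  | exhausted (flag : Bool) (D : Derivation L) (S : List (Frame L))
      (A : Atom L) (anc : Finset ℕ) (rest : List (Subgoal L))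
      (sel : D.last.goal = ⟨.pos A, anc⟩ :: rest) :
      Step P Q r (.run flag (.expand D [] :: S)) (.run flag S)
  /-- The next clause is not applicable. -/
  | inapplicable (flag : Bool) (D : Derivation L) (C : Clause L) (todo : List (Clause L))
      (S : List (Frame L)) (A : Atom L) (anc : Finset ℕ) (rest : List (Subgoal L))
      (sel : D.last.goal = ⟨.pos A, anc⟩ :: rest)
      (napp : ¬ D.Applicable A C) :
      Step P Q r (.run flag (.expand D (C :: todo) :: S)) (.run flag (.expand D todo :: S))
  /-- A prefix satisfying the conditions of LP-check is produced, and it does not have the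
  term-size decrease property. -/
  | violate (flag : Bool) (D : Derivation L) (C : Clause L) (todo : List (Clause L))
      (S : List (Frame L)) (A : Atom L) (anc : Finset ℕ) (rest : List (Subgoal L))
      (sel : D.last.goal = ⟨.pos A, anc⟩ :: rest)
      (app : D.Applicable A C)
      (g : ℕ → ℕ) (pre : D.IsLoopPrefix r C g) (dec : ¬ D.TermSizeDecrease r g) :
      Step P Q r (.run flag (.expand D (C :: todo) :: S)) (.halt .predictedNonTerminating)
  /-- Prefixes satisfying the conditions of LP-check are produced, and they all have the
  term-size decrease property: set the flag to `1` and skip the looping clause. -/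
  | skip (flag : Bool) (D : Derivation L) (C : Clause L) (todo : List (Clause L))
      (S : List (Frame L)) (A : Atom L) (anc : Finset ℕ) (rest : List (Subgoal L))
      (sel : D.last.goal = ⟨.pos A, anc⟩ :: rest)
      (app : D.Applicable A C)
      (pre : ∃ g, D.IsLoopPrefix r C g)
      (dec : ∀ g, D.IsLoopPrefix r C g → D.TermSizeDecrease r g) :
      Step P Q r (.run flag (.expand D (C :: todo) :: S)) (.run true (.expand D todo :: S))
  /-- No such prefix is produced: create the child obtained by applying the clause. -/
  | resolve (flag : Bool) (D : Derivation L) (C : Clause L) (todo : List (Clause L))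
      (S : List (Frame L)) (A : Atom L) (anc : Finset ℕ) (rest : List (Subgoal L))
      (sel : D.last.goal = ⟨.pos A, anc⟩ :: rest)
      (npre : ¬ ∃ g, D.IsLoopPrefix r C g)
      (ρ : ℕ → ℕ) (apart : D.RenamesApart C ρ)
      (θ : Subst L) (mgu : IsResolutionMgu D.last.inputVars θ A (C.rename ρ).head) :
      Step P Q r (.run flag (.expand D (C :: todo) :: S))
        (.run flag (.expand (D.resolve ⟨.pos A, anc⟩ rest C ρ θ) P :: .expand D todo :: S))
  /-- A ground negative subgoal is selected: start its subsidiary tree. -/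
  | enterNeg (flag : Bool) (D : Derivation L) (todo : List (Clause L)) (S : List (Frame L))
      (A : Atom L) (anc : Finset ℕ) (rest : List (Subgoal L))
      (sel : D.last.goal = ⟨.neg A, anc⟩ :: rest) (ground : A.vars = ∅) :
      Step P Q r (.run flag (.expand D todo :: S))
        (.run flag (.expand (D.enterNeg A anc) P :: .await D :: S))
  /-- The subsidiary tree has been completed without a success leaf: go on with the remaining
  subgoals. -/
  | solveNeg (flag : Bool) (D : Derivation L) (S : List (Frame L)) :
      Step P Q r (.run flag (.await D :: S)) (.run flag (.expand D.solveNeg P :: S))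
  /-- A node at which a non-ground negative subgoal is selected is a leaf (flounder leaf). -/
  | flounder (flag : Bool) (D : Derivation L) (todo : List (Clause L)) (S : List (Frame L))
      (A : Atom L) (anc : Finset ℕ) (rest : List (Subgoal L))
      (sel : D.last.goal = ⟨.neg A, anc⟩ :: rest) (nonground : A.vars ≠ ∅) :
      Step P Q r (.run flag (.expand D todo :: S)) (.run flag S)

/-- The procedure TPoLP(`P`, `Q`, `r`) terminates: it has no infinite run, and a run can only
end by returning an answer. -/
def TPoLPTerminates (P : Program L) (Q : Query L) (r : ℕ) : Prop :=
  (¬ ∃ run : ℕ → State L, run 0 = .start ∧ ∀ n, Step P Q r (run n) (run (n + 1))) ∧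
    ∀ s, Relation.ReflTransGen (Step P Q r) .start s →
      (¬ ∃ s', Step P Q r s s') → ∃ a, s = .halt a

end LogicProg

/-! Whether the term-size decrease property holds only decides between skipping a clause and
halting. In both cases a completed loop prefix gets no child, so it is enough that the tree with all
such branches cut is well-founded.

Attach to each subgoal of a goal its history, a list of clause applications made at its ancestors.
Most general unifiers create no function symbols (`IsMgu.funcSet_subset`), and the predicate of a
resolved atom is that of a clause head, so all symbol strings occurring in histories are words over
one finite alphabet. If a history could grow forever, Higman's lemma would give a subsequence with a
constant clause in which every symbol string is a subsequence of all later ones. Its r-th member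
would complete a loop prefix and would have been cut. Hence growth of histories is well-founded
(`wellFounded_histStep`).

A goal corresponds to a list of histories. Resolution replaces the first one, h, by finitely many
copies of a one-step extension of h and keeps the others. As for a multiset order, nested induction
shows that this process stops (`historiesAcc_cons`). A negation arc keeps the history and makes the
atom positive; solving a negative subgoal drops a list member. So the cut tree is well-founded, and
the depth-first stack inherits this because only finitely many clauses are tried at each node
(`StackAcc.expand`).

That a run stops only at an answer is a case check. Its one substantial case needs an mgu respecting
the conventions on variables, obtained from a unification algorithm that orients variable pairs by a
rank (`exists_isResolutionMgu`). -/

namespace LogicProg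

open FirstOrder.Language (Term)

universe u v

variable {L : FirstOrder.Language.{u, v}}

/-! ### Terms and substitutions -/

/-- The set of function symbols of a term. -/
def funcSet : Tm L → Set (Σ n, L.Functions n)
  | .var _ => ∅
  | .func f ts => {⟨_, f⟩} ∪ ⋃ i, funcSet (ts i)

/-- The number of symbols of a term. -/
def termSize : Tm L → ℕ
  | .var _ => 1
  | .func _ ts => 1 + ∑ i, termSize (ts i)

theorem finite_funcSet (t : Tm L) : (funcSet t).Finite := by
  induction t with
  | var => exact Set.finite_empty
  | func f ts ih => exact (Set.finite_singleton _).union (Set.finite_iUnion ih)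

theorem funcSet_subset_subst (t : Tm L) (θ : Subst L) : funcSet t ⊆ funcSet (t.subst θ) := by
  induction t with
  | var => exact Set.empty_subset _
  | func f ts ih => exact Set.union_subset_union_right _ (Set.iUnion_mono ih)

theorem funcSet_subst_subset {F : Set (Σ n, L.Functions n)} {θ : Subst L} {t : Tm L}
    (ht : funcSet t ⊆ F) (hθ : ∀ x, funcSet (θ x) ⊆ F) : funcSet (t.subst θ) ⊆ F := by
  induction t with
  | var x => exact hθ x
  | func f ts ih =>
    simp only [funcSet, Set.union_subset_iff, Set.iUnion_subset_iff] at ht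
    simp only [Term.subst, funcSet, Set.union_subset_iff, Set.iUnion_subset_iff]
    exact ⟨ht.1, fun i => ih i (ht.2 i)⟩

theorem mem_varFinset_func {n : ℕ} {f : L.Functions n} {ts : Fin n → Tm L} {x : ℕ} :
    x ∈ (Term.func f ts : Tm L).varFinset ↔ ∃ i, x ∈ (ts i).varFinset := by
  simp [Term.varFinset]

theorem mem_varFinset_var {x y : ℕ} :
    x ∈ (Term.var y : Tm L).varFinset ↔ x = y := by
  simp [Term.varFinset]

theorem mem_varFinset_subst {t : Tm L} {θ : Subst L} {y : ℕ} :
    y ∈ (t.subst θ).varFinset ↔ ∃ x ∈ t.varFinset, y ∈ (θ x).varFinset := by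
  induction t with
  | var x => simp [Term.subst, Term.varFinset]
  | func f ts ih =>
    simp only [Term.subst, mem_varFinset_func, ih]
    grind

theorem subst_subst (t : Tm L) (θ τ : Subst L) :
    (t.subst θ).subst τ = t.subst fun x => (θ x).subst τ := by
  induction t with
  | var x => rfl
  | func f ts ih => simp [Term.subst, ih]

theorem subst_congr {t : Tm L} {θ τ : Subst L} (h : ∀ x ∈ t.varFinset, θ x = τ x) :
    t.subst θ = t.subst τ := by
  induction t with
  | var x => exact h x (mem_varFinset_var.2 rfl)
  | func f ts ih =>
    simp only [Term.subst, Term.func.injEq, heq_eq_eq, true_and]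
    exact funext fun i => ih i fun x hx => h x (mem_varFinset_func.2 ⟨i, hx⟩)

theorem subst_var (t : Tm L) : t.subst .var = t := by
  induction t with
  | var x => rfl
  | func f ts ih => simp [Term.subst, ih]

theorem eq_var_of_subst_eq_self {t : Tm L} {θ : Subst L} (h : t.subst θ = t) {x : ℕ}
    (hx : x ∈ t.varFinset) : θ x = .var x := by
  induction t with
  | var y => obtain rfl := mem_varFinset_var.1 hx; exact h
  | func f ts ih =>
    simp only [Term.subst, Term.func.injEq, heq_eq_eq, true_and] at h
    obtain ⟨i, hi⟩ := mem_varFinset_func.1 hx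
    exact ih i (congrFun h i) hi

theorem termSize_le_subst {t : Tm L} {θ : Subst L} {x : ℕ} (hx : x ∈ t.varFinset) :
    termSize (θ x) ≤ termSize (t.subst θ) := by
  induction t with
  | var y => obtain rfl := mem_varFinset_var.1 hx; exact le_rfl
  | func f ts ih =>
    obtain ⟨i, hi⟩ := mem_varFinset_func.1 hx
    refine (ih i hi).trans ?_
    have := Finset.single_le_sum (f := fun i => termSize ((ts i).subst θ))
      (fun _ _ => Nat.zero_le _) (Finset.mem_univ i)
    simp only [Term.subst, termSize]
    omega

/-- The occurs check. -/
theorem notMem_varFinset_of_unifies {t : Tm L} {σ : Subst L} {x : ℕ} (ht : t ≠ .var x)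
    (h : σ x = t.subst σ) : x ∉ t.varFinset := by
  intro hx
  cases t with
  | var y => exact ht (by rw [mem_varFinset_var.1 hx])
  | func f ts =>
    obtain ⟨i, hi⟩ := mem_varFinset_func.1 hx
    -- The term `σ x` would occur properly inside `t.subst σ`, which is `σ x` again, so its size
    -- would be less than itself.
    have h1 := termSize_le_subst (θ := σ) hi
    have h2 := Finset.single_le_sum (f := fun i => termSize ((ts i).subst σ))
      (fun _ _ => Nat.zero_le _) (Finset.mem_univ i)
    rw [h] at h1
    simp only [Term.subst, termSize] at h1 h2
    omega

/-! ### Unification -/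

/-- `z` and `u` form a disagreement pair: every unifier in `U` identifies them. The function
symbols of `u` are in `F`, all variables are in `V`, and replacing `z` by `u` does not decrease
the rank of a variable. -/
structure IsDisagreement (U : Set (Subst L)) (F : Set (Σ n, L.Functions n)) (V : Set ℕ)
    (rank : ℕ → ℕ) (z : ℕ) (u : Tm L) : Prop where
  ne : u ≠ .var z
  unifies : ∀ σ ∈ U, σ z = u.subst σ
  func : funcSet u ⊆ F
  mem : z ∈ V
  vars : ∀ y ∈ u.varFinset, y ∈ V
  rank_le : ∀ y, u = .var y → rank z ≤ rank y

/-- Descend simultaneously into both terms, at each level choosing an argument where they differ,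
until one side is a variable. The existence of a unifier excludes a clash of function symbols on the
way. If both sides are variables, the one of smaller rank is the one to be replaced. -/
theorem exists_isDisagreement {U : Set (Subst L)} {F : Set (Σ n, L.Functions n)} {V : Set ℕ}
    (rank : ℕ → ℕ) {s t : Tm L} (hU : U.Nonempty)
    (h : ∀ σ ∈ U, s.subst σ = t.subst σ) (ne : s ≠ t)
    (hs : funcSet s ⊆ F) (ht : funcSet t ⊆ F)
    (vs : ∀ y ∈ s.varFinset, y ∈ V) (vt : ∀ y ∈ t.varFinset, y ∈ V) :
    ∃ z u, IsDisagreement U F V rank z u := by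
  induction s generalizing t with
  | var z =>
    cases t with
    | var y =>
      have hzy : z ≠ y := fun e => ne (by rw [e])
      have hz := vs z (mem_varFinset_var.2 rfl)
      have hy := vt y (mem_varFinset_var.2 rfl)
      rcases le_total (rank z) (rank y) with hr | hr
      · refine ⟨z, .var y, ?_, h, ht, hz, vt, ?_⟩
        · rintro ⟨⟩; exact hzy rfl
        · rintro _ ⟨⟩; exact hr
      · refine ⟨y, .var z, ?_, fun σ hσ => (h σ hσ).symm, ht, hy, vs, ?_⟩
        · rintro ⟨⟩; exact hzy rfl
        · rintro _ ⟨⟩; exact hr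
    | func g us =>
      exact ⟨z, .func g us, nofun, h, ht, vs z (mem_varFinset_var.2 rfl), vt, nofun⟩
  | @func n f ts ih =>
    cases t with
    | var y =>
      exact ⟨y, .func f ts, nofun, fun σ hσ => (h σ hσ).symm, hs,
        vt y (mem_varFinset_var.2 rfl), vs, nofun⟩
    | @func m g us =>
      obtain ⟨σ₀, hσ₀⟩ := hU
      have h0 := h σ₀ hσ₀
      simp only [Term.subst, Term.func.injEq] at h0
      obtain ⟨rfl, h1, -⟩ := h0
      obtain rfl := eq_of_heq h1
      obtain ⟨i, hi⟩ : ∃ i, ts i ≠ us i := by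
        by_contra! hc
        exact ne (by rw [funext hc])
      simp only [funcSet, Set.union_subset_iff, Set.iUnion_subset_iff] at hs ht
      refine ih i (fun σ hσ => ?_) hi (hs.2 i) (ht.2 i)
        (fun y hy => vs y (mem_varFinset_func.2 ⟨i, hy⟩))
        (fun y hy => vt y (mem_varFinset_func.2 ⟨i, hy⟩))
      have := h σ hσ
      simp only [Term.subst, Term.func.injEq, heq_eq_eq, true_and] at this
      exact congrFun this i

/-- All function symbols of the atom are in `F`. -/
def Atom.FuncsIn (F : Set (Σ n, L.Functions n)) (A : Atom L) : Prop :=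
  ∀ i, funcSet (A.args i) ⊆ F

theorem Atom.FuncsIn.subst {F : Set (Σ n, L.Functions n)} {A : Atom L} {θ : Subst L}
    (hA : A.FuncsIn F) (hθ : ∀ x, funcSet (θ x) ⊆ F) : (A.subst θ).FuncsIn F :=
  fun i => funcSet_subst_subset (hA i) hθ

theorem Atom.mem_vars {A : Atom L} {x : ℕ} : x ∈ A.vars ↔ ∃ i, x ∈ (A.args i).varFinset := by
  simp [Atom.vars]

theorem Atom.mem_vars_subst {A : Atom L} {θ : Subst L} {y : ℕ} :
    y ∈ (A.subst θ).vars ↔ ∃ x ∈ A.vars, y ∈ (θ x).varFinset := by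
  simp only [Atom.mem_vars, Atom.subst, mem_varFinset_subst]
  grind

theorem Unifies.pred_eq {σ : Subst L} {A B : Atom L} (h : Unifies σ A B) :
    (⟨A.arity, A.pred⟩ : Σ n, L.Relations n) = ⟨B.arity, B.pred⟩ :=
  
  (congrArg (fun C : Atom L => (⟨C.arity, C.pred⟩ : Σ n, L.Relations n))
    (show A.subst σ = B.subst σ from h) :)

/-- A substitution approximating an mgu of `A` and `B`. -/
structure IsPreMgu (F : Set (Σ n, L.Functions n)) (rank : ℕ → ℕ) (A B : Atom L)
    (θ : Subst L) : Prop where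
  general : ∀ σ : Subst L, Unifies σ A B → ∀ x, σ x = (θ x).subst σ
  idem : ∀ x, (θ x).subst θ = θ x
  outside : ∀ x, x ∉ A.vars ∪ B.vars → θ x = .var x
  inside : ∀ x, x ∈ A.vars ∪ B.vars → (θ x).varFinset ⊆ A.vars ∪ B.vars
  rank_le : ∀ x y, θ x = .var y → rank x ≤ rank y
  func : ∀ x, funcSet (θ x) ⊆ F

theorem IsPreMgu.id (F : Set (Σ n, L.Functions n)) (rank : ℕ → ℕ) (A B : Atom L) :
    IsPreMgu F rank A B .var where
  general _ _ _ := rfl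
  idem _ := rfl
  outside _ _ := rfl
  inside x hx := by
    intro y hy
    rwa [mem_varFinset_var.1 hy]
  rank_le x y h := by cases h; rfl
  func _ := Set.empty_subset _

theorem IsPreMgu.exists_isDisagreement {F : Set (Σ n, L.Functions n)} {rank : ℕ → ℕ}
    {A B : Atom L} {θ : Subst L} (h : IsPreMgu F rank A B θ) (hA : A.FuncsIn F)
    (hB : B.FuncsIn F) (hU : ∃ σ, Unifies σ A B) (hθ : ¬ Unifies θ A B) :
    ∃ z u, IsDisagreement {σ | Unifies σ A B} F {x | x ∈ A.vars ∪ B.vars ∧ θ x = .var x}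
      rank z u := by
  have hvars : ∀ C : Atom L, C.vars ⊆ A.vars ∪ B.vars → ∀ i, ∀ y ∈ ((C.args i).subst θ).varFinset,
      y ∈ {x | x ∈ A.vars ∪ B.vars ∧ θ x = .var x} := by
    intro C hC i y hy
    obtain ⟨x, hx, hxy⟩ := mem_varFinset_subst.1 hy
    exact ⟨h.inside x (hC (Atom.mem_vars.2 ⟨i, hx⟩)) hxy,
      eq_var_of_subst_eq_self (h.idem x) hxy⟩
  have hvA := hvars A Finset.subset_union_left
  have hvB := hvars B Finset.subset_union_right
  have hgen := h.general
  generalize hV : {x | x ∈ A.vars ∪ B.vars ∧ θ x = .var x} = V at hvA hvB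
  clear hV hvars
  obtain ⟨n, p, a⟩ := A
  obtain ⟨m, q, b⟩ := B
  obtain ⟨σ₀, hσ₀⟩ := hU
  have h0 := hσ₀
  simp only [Unifies, Atom.subst, Atom.mk.injEq] at h0
  obtain ⟨rfl, h1, -⟩ := h0
  obtain rfl := eq_of_heq h1
  obtain ⟨i, hi⟩ : ∃ i, (a i).subst θ ≠ (b i).subst θ := by
    by_contra! hc
    exact hθ (by simp only [Unifies, Atom.subst, funext hc])
  refine LogicProg.exists_isDisagreement rank ⟨σ₀, hσ₀⟩ (fun σ hσ => ?_) hi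
    ((hA.subst h.func) i) ((hB.subst h.func) i) (hvA i) (hvB i)
  rw [subst_subst, subst_subst, ← funext (hgen σ hσ)]
  simp only [Set.mem_ofPred_eq, Unifies, Atom.subst, Atom.mk.injEq, heq_eq_eq, true_and] at hσ
  exact congrFun hσ i

/-- The substitution `z/u`. -/
def single (z : ℕ) (u : Tm L) : Subst L := Function.update .var z u

theorem single_self (z : ℕ) (u : Tm L) : single z u z = u := Function.update_self ..

theorem single_of_ne {z x : ℕ} (u : Tm L) (h : x ≠ z) : single z u x = .var x :=
  Function.update_of_ne h ..

theorem mem_varFinset_subst_single {z y : ℕ} {u t : Tm L}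
    (h : y ∈ (t.subst (single z u)).varFinset) :
    y ∈ u.varFinset ∨ y ∈ t.varFinset ∧ y ≠ z := by
  obtain ⟨x, hx, hxy⟩ := mem_varFinset_subst.1 h
  by_cases e : x = z
  · subst e
    rw [single_self] at hxy
    exact .inl hxy
  · rw [single_of_ne u e, mem_varFinset_var] at hxy
    subst hxy
    exact .inr ⟨hx, e⟩

/-- One step of the unification algorithm. By idempotence the variables in the range of `θ` are
fixed by `θ`; composing with `z/u` eliminates `z` and brings in only the variables of `u`, which are
also fixed. The occurs check `hz` is what keeps `z` from returning and so preserves idempotence. -/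
theorem IsPreMgu.comp_single {F : Set (Σ n, L.Functions n)} {rank : ℕ → ℕ}
    {A B : Atom L} {θ : Subst L} (h : IsPreMgu F rank A B θ) {z : ℕ} {u : Tm L}
    (hd : IsDisagreement {σ | Unifies σ A B} F {x | x ∈ A.vars ∪ B.vars ∧ θ x = .var x}
      rank z u) (hz : z ∉ u.varFinset) :
    IsPreMgu F rank A B fun x => (θ x).subst (single z u) where
  general σ hσ x := by
    rw [subst_subst, h.general σ hσ x]
    refine subst_congr fun y _ => ?_
    by_cases e : y = z
    · subst e
      rw [single_self, hd.unifies σ hσ]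
    · rw [single_of_ne u e]; rfl
  idem x := by
    conv_rhs => rw [← subst_var ((θ x).subst (single z u))]
    refine subst_congr fun y hy => ?_
    have hyz : y ≠ z ∧ θ y = .var y := by
      rcases mem_varFinset_subst_single hy with hy | hy
      · exact ⟨fun e => hz (e ▸ hy), (hd.vars y hy).2⟩
      · exact ⟨hy.2, eq_var_of_subst_eq_self (h.idem x) hy.1⟩
    rw [hyz.2]
    exact single_of_ne u hyz.1
  outside x hx := by
    rw [h.outside x hx]
    exact single_of_ne u fun e => hx (e ▸ hd.mem.1)
  inside x hx y hy := by
    rcases mem_varFinset_subst_single hy with hy | hy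
    · exact (hd.vars y hy).1
    · exact h.inside x hx hy.1
  rank_le x y hxy := by
    cases hx : θ x with
    | func f ts => simp [hx, Term.subst] at hxy
    | var w =>
      rw [hx] at hxy
      change single z u w = _ at hxy
      refine (h.rank_le x w hx).trans ?_
      by_cases e : w = z
      · subst e
        rw [single_self] at hxy
        exact hd.rank_le y hxy
      · rw [single_of_ne u e] at hxy
        cases hxy
        rfl
  func x := by
    refine funcSet_subst_subset (h.func x) fun y => ?_
    by_cases e : y = z
    · rw [e, single_self]; exact hd.func
    · rw [single_of_ne u e]; exact Set.empty_subset _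

/-- The measure is the number of variables of `A` and `B` that `θ` leaves fixed: each elimination of
a disagreement removes `z` from this set and adds nothing to it. -/
theorem IsPreMgu.exists_unifies {F : Set (Σ n, L.Functions n)} {rank : ℕ → ℕ}
    {A B : Atom L} (hA : A.FuncsIn F) (hB : B.FuncsIn F) (hU : ∃ σ, Unifies σ A B) (n : ℕ) :
    ∀ θ, IsPreMgu F rank A B θ → {x | x ∈ A.vars ∪ B.vars ∧ θ x = .var x}.ncard ≤ n →
      ∃ θ', IsPreMgu F rank A B θ' ∧ Unifies θ' A B := by
  induction n with
  | zero =>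
    intro θ h hn
    by_contra! hc
    obtain ⟨z, u, hd⟩ := h.exists_isDisagreement hA hB hU (hc θ h)
    have hfin : {x | x ∈ A.vars ∪ B.vars ∧ θ x = .var x}.Finite :=
      (A.vars ∪ B.vars).finite_toSet.subset fun x hx => hx.1
    have := (Set.ncard_pos hfin).2 ⟨z, hd.mem⟩
    omega
  | succ n ih =>
    intro θ h hn
    by_cases hu : Unifies θ A B
    · exact ⟨θ, h, hu⟩
    obtain ⟨z, u, hd⟩ := h.exists_isDisagreement hA hB hU hu
    obtain ⟨σ, hσ⟩ := hU
    have hz := notMem_varFinset_of_unifies hd.ne (hd.unifies σ hσ)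
    refine ih _ (h.comp_single hd hz) ?_
    have hfin : {x | x ∈ A.vars ∪ B.vars ∧ θ x = .var x}.Finite :=
      (A.vars ∪ B.vars).finite_toSet.subset fun x hx => hx.1
    refine Nat.le_of_lt_succ (lt_of_lt_of_le (Set.ncard_lt_ncard ⟨?_, ?_⟩ hfin) hn)
    · rintro x ⟨hx, hxx⟩
      refine ⟨hx, ?_⟩
      cases hw : θ x with
      | func f ts => simp [hw, Term.subst] at hxx
      | var w =>
        rw [hw] at hxx
        change single z u w = _ at hxx
        by_cases e : w = z
        · subst e
          rw [single_self] at hxx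
          have := (hd.vars x (by rw [hxx]; exact mem_varFinset_var.2 rfl)).2
          rw [← hw, this]
        · rw [← hxx, single_of_ne u e]
    · intro hsub
      have h1 := (hsub hd.mem).2
      rw [hd.mem.2] at h1
      exact hd.ne ((single_self z u).symm.trans h1)

/-- The unification theorem. -/
theorem exists_isMgu {F : Set (Σ n, L.Functions n)} (rank : ℕ → ℕ)
    {A B : Atom L} (hA : A.FuncsIn F) (hB : B.FuncsIn F) (hU : ∃ σ, Unifies σ A B) :
    ∃ θ, IsMgu θ A B ∧ (∀ x y, θ x = .var y → rank x ≤ rank y) ∧ ∀ x, funcSet (θ x) ⊆ F := by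
  obtain ⟨θ, h, hu⟩ := IsPreMgu.exists_unifies hA hB hU _ _ (.id F rank A B) le_rfl
  exact ⟨θ, ⟨hu, fun σ hσ => ⟨σ, h.general σ hσ⟩, h.idem, h.outside, h.inside⟩, h.rank_le, h.func⟩

/-- The unification algorithm yields one mgu with symbols in `F`. An arbitrary mgu has that one as
an instance, and instantiation never removes function symbols. -/
theorem IsMgu.funcSet_subset {F : Set (Σ n, L.Functions n)} {A B : Atom L} {θ : Subst L}
    (h : IsMgu θ A B) (hA : A.FuncsIn F) (hB : B.FuncsIn F) (x : ℕ) : funcSet (θ x) ⊆ F := by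
  obtain ⟨θ', h', -, hF⟩ := exists_isMgu (fun _ => 0) hA hB ⟨θ, h.unifies⟩
  obtain ⟨τ, hτ⟩ := h.general θ' h'.unifies
  refine (funcSet_subset_subst _ τ).trans ?_
  rw [← hτ]
  exact hF x

/-- The two conventions amount to rank monotonicity when input variables of the subgoal rank above
its other variables, and these above all remaining variables. An input variable outside the subgoal
is not in the clause head either, so it is left fixed. -/
theorem exists_isResolutionMgu {I : Set ℕ} {A H : Atom L} (hI : ∀ x ∈ I, x ∉ H.vars)
    (hU : ∃ σ, Unifies σ A H) : ∃ θ, IsResolutionMgu I θ A H := by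
  classical
  obtain ⟨θ, h, hr, -⟩ := exists_isMgu (F := Set.univ)
    (fun x => if x ∈ A.vars then if x ∈ I then 2 else 1 else 0)
    (fun _ => Set.subset_univ _) (fun _ => Set.subset_univ _) hU
  refine ⟨θ, h, fun x y hxy hx => ?_, fun x y hxy hx => ?_⟩
  · have := hr x y hxy
    simp only [hx, if_true] at this
    by_contra hy
    simp only [hy, if_false] at this
    split_ifs at this <;> omega
  · by_cases hxA : x ∈ A.vars
    · have := hr x y hxy
      simp only [hxA, hx, if_true] at this
      by_contra hy
      simp only [hy, if_false] at this
      split_ifs at this <;> omega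
    · have := h.outside x (by simp [hxA, hI x hx])
      rw [this] at hxy
      cases hxy
      exact hx

/-! ### Histories of subgoals -/

/-- The application of a program clause to an atom selected at a position of a derivation. -/
structure Entry (L : FirstOrder.Language.{u, v}) where
  pos : ℕ
  clause : Clause L
  atom : Atom L

/-- The clause of the entry is in `P`, and the symbols of its atom come from `P` and `F`. -/
structure Entry.IsOver (P : Program L) (F : Set (Σ n, L.Functions n)) (x : Entry L) : Prop where
  mem : x.clause ∈ P
  funcs : x.atom.FuncsIn F
  pred : (⟨x.atom.arity, x.atom.pred⟩ : Σ n, L.Relations n) =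
    ⟨x.clause.head.arity, x.clause.head.pred⟩

/-- The entry `x` ends a chain of `r` entries which loop each into the next one, the others being
in `h`. -/
def EndsChain (r : ℕ) (h : List (Entry L)) (x : Entry L) : Prop :=
  ∃ y : ℕ → Entry L, y r = x ∧ ∀ j, 1 ≤ j → j < r →
    y j ∈ h ∧ (y j).pos < (y (j + 1)).pos ∧ (y j).clause = x.clause ∧
      LoopsInto (y j).atom (y (j + 1)).atom

/-- `h'` is `h` with a later entry added that does not end a chain of `r` entries. -/
def HistStep (P : Program L) (F : Set (Σ n, L.Functions n)) (r : ℕ)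
    (h' h : List (Entry L)) : Prop :=
  ∃ x, h' = x :: h ∧ (∀ y ∈ h, y.pos < x.pos) ∧ x.IsOver P F ∧ ¬ EndsChain r h x

/-- The symbols of symbol strings over `P` and `F`. -/
def alphabet (P : Program L) (F : Set (Σ n, L.Functions n)) : Set (Sym L) :=
  {Sym.X} ∪ (fun f => Sym.func f.2) '' F ∪ (fun C => Sym.pred C.head.pred) '' {C | C ∈ P}

theorem finite_alphabet (P : Program L) {F : Set (Σ n, L.Functions n)} (hF : F.Finite) :
    (alphabet P F).Finite :=
  ((Set.finite_singleton _).union (hF.image _)).union ((List.finite_toSet P).image _)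

theorem mem_alphabet_of_mem_symbolString (P : Program L) {F : Set (Σ n, L.Functions n)} {t : Tm L}
    (ht : funcSet t ⊆ F) {s : Sym L} (hs : s ∈ symbolString t) : s ∈ alphabet P F := by
  induction t with
  | var x =>
    simp only [symbolString, Term.listEncode, List.map_cons, List.map_nil,
      List.mem_singleton] at hs
    exact .inl (.inl hs)
  | @func n f ts ih =>
    simp only [funcSet, Set.union_subset_iff, Set.iUnion_subset_iff] at ht
    simp only [symbolString, Term.listEncode, List.map_cons, List.mem_cons, List.map_flatMap,
      List.mem_flatMap] at hs
    rcases hs with rfl | ⟨i, -, hi⟩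
    · exact .inl (.inr ⟨⟨n, f⟩, ht.1 rfl, rfl⟩)
    · exact ih i (ht.2 i) hi

theorem Entry.IsOver.symbolString_subset {P : Program L} {F : Set (Σ n, L.Functions n)}
    {x : Entry L} (hx : x.IsOver P F) : ∀ s ∈ x.atom.symbolString, s ∈ alphabet P F := by
  intro s hs
  rcases List.mem_cons.1 hs with rfl | hs
  · refine .inr ⟨x.clause, hx.mem, ?_⟩
    exact congrArg (fun p : Σ n, L.Relations n => Sym.pred p.2) hx.pred.symm
  · obtain ⟨l, hl, hsl⟩ := List.mem_flatten.1 hs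
    obtain ⟨i, rfl⟩ := List.mem_ofFn.1 hl
    exact mem_alphabet_of_mem_symbolString P (hx.funcs i) hsl

/-- Higman's lemma for pairs of a program clause and a symbol string. -/
theorem partiallyWellOrderedOn_symbolStrings (P : Program L) {F : Set (Σ n, L.Functions n)}
    (hF : F.Finite) :
    ({C | C ∈ P} ×ˢ {l : List (Sym L) | ∀ s ∈ l, s ∈ alphabet P F}).PartiallyWellOrderedOn
      fun p q : Clause L × List (Sym L) => p.1 = q.1 ∧ p.2.Sublist q.2 := by
  have h1 : {C | C ∈ P}.PartiallyWellOrderedOn (Eq : Clause L → Clause L → Prop) :=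
    (List.finite_toSet P).partiallyWellOrderedOn
  have h2 := Set.PartiallyWellOrderedOn.partiallyWellOrderedOn_sublistForall₂ Eq
    ((finite_alphabet P hF).partiallyWellOrderedOn (r := Eq))
  have h3 : List.SublistForall₂ (Eq : Sym L → Sym L → Prop) = List.Sublist := by
    funext l l'
    simp [List.sublistForall₂_iff, List.forall₂_eq_eq_eq]
  rw [h3] at h2
  exact h1.prod h2

/-- An infinite descent adds entries at increasing positions. Higman's lemma extracts a monotone
subsequence of their pairs (clause, symbol string), and its members of index 1 to `r` form a chain,
contrary to the condition under which the last of them was added. -/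
theorem wellFounded_histStep (P : Program L) {F : Set (Σ n, L.Functions n)} (hF : F.Finite)
    (r : ℕ) : WellFounded (HistStep P F r) := by
  rw [wellFounded_iff_isEmpty_descending_chain]
  refine ⟨fun ⟨f, hf⟩ => ?_⟩
  choose x hx hpos hover hchain using hf
  have hsub : ∀ m n, m ≤ n → f m ⊆ f n := fun m n hmn =>
    Nat.le_induction (fun _ h => h)
      (fun k _ ih y hy => by rw [hx]; exact List.mem_cons_of_mem _ (ih hy)) n hmn
  have hmem : ∀ m n, m < n → x m ∈ f n := fun m n hmn =>
    hsub (m + 1) n hmn (by rw [hx]; exact List.mem_cons_self)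
  have : IsPreorder (Clause L × List (Sym L)) fun p q => p.1 = q.1 ∧ p.2.Sublist q.2 :=
    { refl := fun _ => ⟨rfl, .refl _⟩
      trans := fun _ _ _ h h' => ⟨h.1.trans h'.1, h.2.trans h'.2⟩ }
  obtain ⟨g, hg⟩ := (partiallyWellOrderedOn_symbolStrings P hF).exists_monotone_subseq
    (f := fun n => ((x n).clause, (x n).atom.symbolString))
    fun n => ⟨(hover n).mem, (hover n).symbolString_subset⟩
  refine hchain (g r) ⟨fun j => x (g j), rfl, fun j _ hj => ⟨hmem _ _ (g.strictMono hj),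
    hpos _ _ (hmem _ _ (g.strictMono j.lt_succ_self)), (hg _ _ hj.le).1, ?_,
    (hg _ _ j.le_succ).2⟩⟩
  -- `LoopsInto` also asks for equal predicate symbols; both atoms have that of the head of their
  -- common clause.
  have hclause : (x (g j)).clause = (x (g (j + 1))).clause := (hg j (j + 1) j.le_succ).1
  rw [(hover _).pred, (hover _).pred, hclause]

/-! ### Well-foundedness of the tree -/

namespace Derivation

theorem Applied.lt {D : Derivation L} {i : ℕ} {C : Clause L} (h : D.Applied i C) :
    i < D.past.length := by
  obtain ⟨N, θ, h⟩ := h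
  exact (List.getElem?_eq_some_iff.1 h).1

theorem Applied.extend {D : Derivation L} {i : ℕ} {C : Clause L} (h : D.Applied i C)
    (e : Edge L) (N : Node L) : (D.extend e N).Applied i C := by
  have hi := h.lt
  obtain ⟨N', θ, h⟩ := h
  exact ⟨N', θ, by rwa [Derivation.extend, List.getElem?_append_left hi]⟩

theorem Selects.extend {D : Derivation L} {i : ℕ} {A : Atom L} {anc : Finset ℕ}
    (h : D.Selects i A anc) (e : Edge L) (N : Node L) : (D.extend e N).Selects i A anc := by
  obtain ⟨N', rest, h, hg⟩ := h
  refine ⟨N', rest, ?_, hg⟩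
  have hi := (List.getElem?_eq_some_iff.1 h).1
  simp only [node?, Derivation.extend, List.map_append, List.map_cons, List.map_nil]
  rw [List.getElem?_append_left hi]
  exact h

theorem selects_last {D : Derivation L} {A : Atom L} {anc : Finset ℕ} {rest : List (Subgoal L)}
    (sel : D.last.goal = ⟨.pos A, anc⟩ :: rest) : D.Selects D.past.length A anc :=
  ⟨D.last, rest, by simp [node?], sel⟩

end Derivation

/-- `h` records applications of program clauses in `D` at ancestors in the set `anc`, of which
earlier ones are ancestors of later ones. -/
def IsHistory (D : Derivation L) (anc : Finset ℕ) (h : List (Entry L)) : Prop :=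
  ∀ y ∈ h, y.pos ∈ anc ∧ D.Applied y.pos y.clause ∧
    ∃ anc', D.Selects y.pos y.atom anc' ∧ ∀ x ∈ h, x.pos < y.pos → x.pos ∈ anc'

theorem IsHistory.extend {D : Derivation L} {anc : Finset ℕ} {h : List (Entry L)}
    (hh : IsHistory D anc h) (e : Edge L) (N : Node L) : IsHistory (D.extend e N) anc h :=
  fun y hy =>
    let ⟨h1, h2, anc', h3, h4⟩ := hh y hy
    ⟨h1, h2.extend e N, anc', h3.extend e N, h4⟩

/-- The new entry sits at the latest position, so the older ones impose no condition on it as an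
earlier ancestor. Conversely all older entries are at ancestors of the selected atom, as the new
entry requires. -/
theorem IsHistory.resolve {D : Derivation L} {anc : Finset ℕ} {h : List (Entry L)}
    (hh : IsHistory D anc h) {A : Atom L} {rest : List (Subgoal L)}
    (sel : D.last.goal = ⟨.pos A, anc⟩ :: rest) (C : Clause L) (ρ : ℕ → ℕ) (θ : Subst L) :
    IsHistory (D.resolve ⟨.pos A, anc⟩ rest C ρ θ) (insert D.past.length anc)
      (⟨D.past.length, C, A⟩ :: h) := by
  intro y hy
  rcases List.mem_cons.1 hy with rfl | hy
  · refine ⟨Finset.mem_insert_self .., ⟨D.last, θ, ?_⟩, anc,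
      (Derivation.selects_last sel).extend _ _, fun x hx hlt => ?_⟩
    · simp [Derivation.resolve, Derivation.extend]
    · rcases List.mem_cons.1 hx with rfl | hx
      · exact absurd hlt (lt_irrefl _)
      · exact (hh x hx).1
  · obtain ⟨h1, h2, anc', h3, h4⟩ := hh y hy
    refine ⟨Finset.mem_insert_of_mem h1, h2.extend _ _, anc', h3.extend _ _, fun x hx hlt => ?_⟩
    rcases List.mem_cons.1 hx with rfl | hx
    · exact absurd hlt h2.lt.not_gt
    · exact h4 x hx hlt

/-- Reading off the positions of a chain gives a loop prefix; the ancestor relation that loop goals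
require is part of `IsHistory`. -/
theorem IsHistory.not_endsChain {D : Derivation L} {anc : Finset ℕ} {h : List (Entry L)}
    (hh : IsHistory D anc h) {A : Atom L} {rest : List (Subgoal L)}
    (sel : D.last.goal = ⟨.pos A, anc⟩ :: rest) {C : Clause L} {r : ℕ}
    (npre : ¬ ∃ g, D.IsLoopPrefix r C g) : ¬ EndsChain r h ⟨D.past.length, C, A⟩ := by
  rintro ⟨y, hy, hc⟩
  refine npre ⟨fun j => (y j).pos, fun j h1 h2 => (hc j h1 h2).2.1, ?_, fun j h1 h2 => ?_,
    fun j h1 h2 => ?_⟩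
  · simp only [hy]
  · obtain ⟨hm, hlt, -, hl⟩ := hc j h1 h2
    obtain ⟨hanc, -, ancj, hsel, -⟩ := hh _ hm
    -- The target of a link is either another entry of the history or, for the last link, the
    -- subgoal selected at the end of `D`, whose ancestor set is `anc`.
    rcases Nat.lt_or_ge (j + 1) r with h3 | h3
    · obtain ⟨-, -, anc', hsel', hanc'⟩ := hh _ (hc (j + 1) (by omega) h3).1
      exact ⟨_, _, _, _, hsel, hsel', hanc' _ hm hlt, hl⟩
    · obtain rfl : r = j + 1 := by omega
      simp only [hy] at hl ⊢
      exact ⟨_, _, _, _, hsel, Derivation.selects_last sel, hanc, hl⟩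
  · have := (hh _ (hc j h1 h2).1).2.1
    rwa [(hc j h1 h2).2.2.1] at this

/-- `D'` is a child of `D` in a tree without the branches cut off by the loop check. -/
inductive Child (P : Program L) (r : ℕ) : Derivation L → Derivation L → Prop
  | resolve (D : Derivation L) (C : Clause L) (A : Atom L) (anc : Finset ℕ)
      (rest : List (Subgoal L)) (ρ : ℕ → ℕ) (θ : Subst L) (mem : C ∈ P)
      (sel : D.last.goal = ⟨.pos A, anc⟩ :: rest)
      (npre : ¬ ∃ g, D.IsLoopPrefix r C g) (mgu : IsMgu θ A (C.rename ρ).head) :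
      Child P r (D.resolve ⟨.pos A, anc⟩ rest C ρ θ) D
  | enterNeg (D : Derivation L) (A : Atom L) (anc : Finset ℕ) (rest : List (Subgoal L))
      (sel : D.last.goal = ⟨.neg A, anc⟩ :: rest) : Child P r (D.enterNeg A anc) D
  | solveNeg (D : Derivation L) (A : Atom L) (anc : Finset ℕ) (rest : List (Subgoal L))
      (sel : D.last.goal = ⟨.neg A, anc⟩ :: rest) : Child P r D.solveNeg D

/-- All function symbols of the clause are in `F`. -/
def Clause.FuncsIn (F : Set (Σ n, L.Functions n)) (C : Clause L) : Prop :=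
  C.head.FuncsIn F ∧ ∀ l ∈ C.body, l.atom.FuncsIn F

theorem Literal.atom_subst (l : Literal L) (θ : Subst L) :
    (l.subst θ).atom = l.atom.subst θ := by
  cases l <;> rfl

theorem Clause.FuncsIn.rename {F : Set (Σ n, L.Functions n)} {C : Clause L} (h : C.FuncsIn F)
    (ρ : ℕ → ℕ) : (C.rename ρ).FuncsIn F := by
  refine ⟨h.1.subst fun _ => Set.empty_subset _, fun l hl => ?_⟩
  obtain ⟨l, hl', rfl⟩ := List.mem_map.1 hl
  rw [Literal.atom_subst]
  exact (h.2 l hl').subst fun _ => Set.empty_subset _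

/-- The lists `hs` are histories of the successive subgoals of the last goal of `D`, and the
function symbols of this goal are in `F`. -/
def HasHistories (F : Set (Σ n, L.Functions n)) (D : Derivation L) (goal : List (Subgoal L))
    (hs : List (List (Entry L))) : Prop :=
  List.Forall₂ (fun s h => IsHistory D s.anc h ∧ s.lit.atom.FuncsIn F) goal hs

theorem HasHistories.extend {F : Set (Σ n, L.Functions n)} {D : Derivation L}
    {goal : List (Subgoal L)} {hs : List (List (Entry L))} (h : HasHistories F D goal hs)
    (e : Edge L) (N : Node L) : HasHistories F (D.extend e N) goal hs :=
  h.imp fun _ _ h => ⟨h.1.extend e N, h.2⟩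

theorem HasHistories.subst {F : Set (Σ n, L.Functions n)} {D : Derivation L}
    {goal : List (Subgoal L)} {hs : List (List (Entry L))} (h : HasHistories F D goal hs)
    {θ : Subst L} (hθ : ∀ x, funcSet (θ x) ⊆ F) :
    HasHistories F D (goal.map fun t => t.subst θ) hs := by
  refine List.forall₂_map_left_iff.2 (h.imp fun s _ h => ⟨h.1, ?_⟩)
  simp only [Subgoal.subst, Literal.atom_subst]
  exact h.2.subst hθ

/-- The tree below a derivation is well-founded if its last goal has the histories `hs`. -/
def HistoriesAcc (P : Program L) (F : Set (Σ n, L.Functions n)) (r : ℕ)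
    (hs : List (List (Entry L))) : Prop :=
  ∀ D : Derivation L, HasHistories F D D.last.goal hs → Acc (Child P r) D

theorem historiesAcc_nil (P : Program L) (F : Set (Σ n, L.Functions n)) (r : ℕ) :
    HistoriesAcc P F r [] := by
  intro D hD
  have hnil : D.last.goal = [] := List.forall₂_nil_right_iff.1 hD
  refine ⟨_, fun D' h => ?_⟩
  cases h with
  | resolve _ C A anc rest ρ θ mem sel => simp [hnil] at sel
  | enterNeg _ A anc rest sel => simp [hnil] at sel
  | solveNeg _ A anc rest sel => simp [hnil] at sel

/-- Outer induction on the growth of the first history, for all tails at once: once the subgoals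
descending from the first one are dealt with, what remains is a goal with histories `hs`, covered by
assumption. -/
theorem historiesAcc_cons {P : Program L} {F : Set (Σ n, L.Functions n)} {r : ℕ}
    (hP : ∀ C ∈ P, C.FuncsIn F) {h : List (Entry L)} (hacc : Acc (HistStep P F r) h) :
    ∀ {hs}, HistoriesAcc P F r hs → HistoriesAcc P F r (h :: hs) := by
  induction hacc with
  | intro h _ ih =>
    -- A negation arc does not extend the history, so the induction hypothesis does not apply to its
    -- target. That target has a positive selected atom, hence positive subgoals are settled first,
    -- with an arbitrary tail so that the empty one can be used for subsidiary trees.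
    have key : ∀ {hs}, HistoriesAcc P F r hs → ∀ D : Derivation L,
        (∃ A anc rest, D.last.goal = ⟨.pos A, anc⟩ :: rest) →
        HasHistories F D D.last.goal (h :: hs) → Acc (Child P r) D := by
      rintro hs hhs D ⟨A, anc, rest, hgoal⟩ hD
      refine ⟨_, fun D' hc => ?_⟩
      cases hc with
      | enterNeg _ A' anc' rest' sel => simp [hgoal] at sel
      | solveNeg _ A' anc' rest' sel => simp [hgoal] at sel
      | resolve _ C A' anc' rest' ρ θ mem sel npre mgu =>
        rw [sel] at hD
        obtain ⟨⟨hh, hA⟩, hrest⟩ := List.forall₂_cons.1 hD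
        have hC := (hP C mem).rename ρ
        have hθ := mgu.funcSet_subset hA hC.1
        have hstep : HistStep P F r (⟨D.past.length, C, A'⟩ :: h) h := by
          refine ⟨_, rfl, fun y hy => (hh y hy).2.1.lt, ⟨mem, hA, ?_⟩,
            hh.not_endsChain sel npre⟩
          exact mgu.unifies.pred_eq
        -- All body literals of the clause share the extended history. The copies are added one at a
        -- time, each by the induction hypothesis for that history.
        have hrep : ∀ k, HistoriesAcc P F r
            (List.replicate k (⟨D.past.length, C, A'⟩ :: h) ++ hs) := by
          intro k
          induction k with
          | zero => exact hhs
          | succ k ihk => exact ih _ hstep ihk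
        refine hrep (C.rename ρ).body.length _ ?_
        refine List.rel_append ?_ ((HasHistories.subst hrest hθ).extend _ _)
        rw [List.forall₂_map_left_iff, List.forall₂_iff_get]
        refine ⟨List.length_replicate.symm, fun i hi _ => ?_⟩
        simp only [List.get_eq_getElem, List.getElem_replicate, Literal.atom_subst]
        exact ⟨hh.resolve sel C ρ θ, (hC.2 _ (List.getElem_mem hi)).subst hθ⟩
    intro hs hhs D hD
    match hgoal : D.last.goal with
    | [] => simp [hgoal, HasHistories] at hD
    | ⟨.pos A, anc⟩ :: rest => exact key hhs D ⟨A, anc, rest, hgoal⟩ hD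
    | ⟨.neg A, anc⟩ :: rest =>
      refine ⟨_, fun D' hc => ?_⟩
      cases hc with
      | resolve _ C A' anc' rest' ρ θ mem sel => simp [hgoal] at sel
      | enterNeg _ A' anc' rest' sel =>
        rw [sel] at hD
        obtain ⟨⟨hh, hA⟩, -⟩ := List.forall₂_cons.1 hD
        exact key (historiesAcc_nil P F r) _ ⟨A', anc', [], rfl⟩
          (.cons ⟨hh.extend _ _, hA⟩ .nil)
      | solveNeg _ A' anc' rest' sel =>
        refine hhs _ ?_
        rw [sel] at hD
        have := (List.forall₂_cons.1 hD).2
        simp only [Derivation.solveNeg, Derivation.extend, sel, List.tail_cons]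
        exact HasHistories.extend this _ _

/-- `F` collects the function symbols of the root atom and of the program; the root subgoal starts
with the empty history. -/
theorem acc_child_root (P : Program L) (Q : Query L) (r : ℕ) (v : Fin Q.arity → ℕ) :
    Acc (Child P r) (Q.root v) := by
  let F : Set (Σ n, L.Functions n) :=
    (⋃ i, funcSet ((Q.rootAtom v).args i)) ∪
      ⋃ C ∈ {C | C ∈ P}, ((⋃ i, funcSet (C.head.args i)) ∪
        ⋃ l ∈ {l | l ∈ C.body}, ⋃ i, funcSet (l.atom.args i))
  have hF : F.Finite := by
    refine (Set.finite_iUnion fun i => finite_funcSet _).union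
      ((List.finite_toSet P).biUnion fun C _ => ?_)
    exact (Set.finite_iUnion fun i => finite_funcSet _).union
      ((List.finite_toSet C.body).biUnion fun l _ => Set.finite_iUnion fun i => finite_funcSet _)
  have hP : ∀ C ∈ P, C.FuncsIn F := by
    intro C hC
    have hsub : _ ⊆ F := (Set.subset_biUnion_of_mem (u := fun C : Clause L =>
      (⋃ i, funcSet (C.head.args i)) ∪ ⋃ l ∈ {l | l ∈ C.body}, ⋃ i, funcSet (l.atom.args i))
      (show C ∈ {C | C ∈ P} from hC)).trans Set.subset_union_right
    refine ⟨fun i => ?_, fun l hl i => ?_⟩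
    · exact ((Set.subset_iUnion (fun i => funcSet (C.head.args i)) i).trans
        Set.subset_union_left).trans hsub
    · exact (((Set.subset_iUnion (fun i => funcSet (l.atom.args i)) i).trans
        (Set.subset_biUnion_of_mem (u := fun l : Literal L => ⋃ i, funcSet (l.atom.args i))
          (show l ∈ {l | l ∈ C.body} from hl))).trans Set.subset_union_right).trans hsub
  refine historiesAcc_cons hP ((wellFounded_histStep P hF r).apply []) (historiesAcc_nil P F r) _
    (.cons ⟨nofun, fun i => ?_⟩ .nil)
  exact (Set.subset_iUnion (fun i => funcSet ((Q.rootAtom v).args i)) i).trans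
    Set.subset_union_left

/-! ### No infinite runs -/

theorem afterSuccess_suffix (S : List (Frame L)) : afterSuccess S <:+ S := by
  unfold afterSuccess
  split
  · exact List.suffix_refl S
  · next F S' h =>
    have := List.dropWhile_suffix (l := S) fun F : Frame L => !F.isAwait
    rw [h] at this
    exact (List.suffix_cons F S').trans this

/-- All runs starting from a lower part of the stack `S` are finite. -/
def StackAcc (P : Program L) (Q : Query L) (r : ℕ) (S : List (Frame L)) : Prop :=
  ∀ S', S' <:+ S → ∀ flag, Acc (fun s' s => Step P Q r s s') (.run flag S')

theorem acc_halt (P : Program L) (Q : Query L) (r : ℕ) (a : Answer) :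
    Acc (fun s' s => Step P Q r s s') (.halt a) :=
  ⟨_, fun _ h => nomatch h⟩

theorem stackAcc_nil (P : Program L) (Q : Query L) (r : ℕ) : StackAcc P Q r [] := by
  intro S' hS' flag
  obtain rfl := List.suffix_nil.1 hS'
  refine ⟨_, fun s h => ?_⟩
  cases h
  exact acc_halt P Q r _

theorem StackAcc.cons {P : Program L} {Q : Query L} {r : ℕ} {S : List (Frame L)} {F : Frame L}
    (hS : StackAcc P Q r S) (hF : ∀ flag s, Step P Q r (.run flag (F :: S)) s →
      Acc (fun s' s => Step P Q r s s') s) : StackAcc P Q r (F :: S) := by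
  intro S' hS' flag
  rcases List.suffix_cons_iff.1 hS' with rfl | h
  · exact ⟨_, hF flag⟩
  · exact hS S' h flag

/-- Outer induction on the tree below `D`, inner induction on the clauses still to be tried. The
stack below is arbitrary because a child is pushed on top of what is left of its parent. Working
with all suffixes of the stack also covers a success in a subsidiary tree, which discards several
frames at once. -/
theorem StackAcc.expand {P : Program L} {Q : Query L} {r : ℕ} {D : Derivation L}
    (hD : Acc (Child P r) D) : ∀ {S : List (Frame L)}, StackAcc P Q r S →
      ∀ todo : List (Clause L), todo ⊆ P → StackAcc P Q r (.expand D todo :: S) := by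
  induction hD with
  | intro D _ ih =>
    intro S hS todo
    induction todo with
    | nil =>
      intro _
      refine hS.cons fun flag s h => ?_
      cases h with
      | success => exact hS _ (afterSuccess_suffix S) _
      | exhausted => exact hS _ (List.suffix_refl S) _
      | flounder => exact hS _ (List.suffix_refl S) _
      | enterNeg _ _ _ _ A anc rest sel ground =>
        -- The only step from a waiting frame on top goes to the child `D.solveNeg`, which the outer
        -- induction hypothesis covers.
        have hawait : StackAcc P Q r (.await D :: S) := by
          refine hS.cons fun flag s h => ?_
          cases h
          exact ih _ (.solveNeg D A anc rest sel) hS P (List.Subset.refl P) _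
            (List.suffix_refl _) _
        exact ih _ (.enterNeg D A anc rest sel) hawait P (List.Subset.refl P) _
          (List.suffix_refl _) _
    | cons C todo iht =>
      intro hP
      have htodo := iht fun C' h => hP (List.mem_cons_of_mem _ h)
      refine hS.cons fun flag s h => ?_
      cases h with
      | success => exact hS _ (afterSuccess_suffix S) _
      | flounder => exact hS _ (List.suffix_refl S) _
      | inapplicable => exact htodo _ (List.suffix_refl _) _
      | violate => exact acc_halt P Q r _
      | skip => exact htodo _ (List.suffix_refl _) _
      | resolve _ _ _ _ _ A anc rest sel npre ρ apart θ mgu =>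
        exact ih _ (.resolve D C A anc rest ρ θ (hP List.mem_cons_self) sel npre mgu.mgu) htodo P
          (List.Subset.refl P) _ (List.suffix_refl _) _
      | enterNeg _ _ _ _ A anc rest sel ground =>
        have hawait : StackAcc P Q r (.await D :: S) := by
          refine hS.cons fun flag s h => ?_
          cases h
          exact ih _ (.solveNeg D A anc rest sel) hS P (List.Subset.refl P) _
            (List.suffix_refl _) _
        exact ih _ (.enterNeg D A anc rest sel) hawait P (List.Subset.refl P) _
          (List.suffix_refl _) _

theorem acc_start (P : Program L) (Q : Query L) (r : ℕ) :
    Acc (fun s' s => Step P Q r s s') .start := by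
  refine ⟨_, fun s h => ?_⟩
  cases h with
  | init v =>
    exact StackAcc.expand (acc_child_root P Q r v) (stackAcc_nil P Q r) P (List.Subset.refl P) _
      (List.suffix_refl _) _

/-! ### Progress -/

theorem Clause.mem_vars {C : Clause L} {x : ℕ} :
    x ∈ C.vars ↔ x ∈ C.head.vars ∨ ∃ l ∈ C.body, x ∈ l.atom.vars := by
  have key : ∀ b : List (Literal L),
      x ∈ (b.map fun l => l.atom.vars).foldr (· ∪ ·) ∅ ↔ ∃ l ∈ b, x ∈ l.atom.vars := by
    intro b
    induction b with
    | nil => simp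
    | cons l b ih => simp [ih]
  simp [Clause.vars, key]

/-- The input variables and the variables of the last goal have occurred in the derivation. -/
def Derivation.VarsUsed (D : Derivation L) : Prop :=
  (∀ s ∈ D.last.goal, s.lit.atom.vars ⊆ D.last.usedVars) ∧
    ∀ x ∈ D.last.inputVars, x ∈ D.last.usedVars

/-- The mgu acts within the variables of the selected atom and the clause head. All of these are
recorded as used after the step, so `θ` maps used variables to terms in used variables. The
invariant serves to keep input variables disjoint from renamed clauses. -/
theorem Derivation.VarsUsed.resolve {D : Derivation L} (h : D.VarsUsed) {A : Atom L}
    {anc : Finset ℕ} {rest : List (Subgoal L)} (sel : D.last.goal = ⟨.pos A, anc⟩ :: rest)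
    {C : Clause L} {ρ : ℕ → ℕ} {θ : Subst L} (mgu : IsMgu θ A (C.rename ρ).head) :
    (D.resolve ⟨.pos A, anc⟩ rest C ρ θ).VarsUsed := by
  have hθ : ∀ x ∈ D.last.usedVars ∪ (C.rename ρ).vars,
      (θ x).varFinset ⊆ D.last.usedVars ∪ (C.rename ρ).vars := by
    intro x hx
    by_cases hxA : x ∈ A.vars ∪ (C.rename ρ).head.vars
    · refine (mgu.inside x hxA).trans (Finset.union_subset_union ?_ ?_)
      · exact h.1 ⟨.pos A, anc⟩ (by rw [sel]; exact List.mem_cons_self)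
      · exact fun y hy => Clause.mem_vars.2 (.inl hy)
    · rw [mgu.outside x hxA]
      intro y hy
      rwa [mem_varFinset_var.1 hy]
  have hatom : ∀ B : Atom L, B.vars ⊆ D.last.usedVars ∪ (C.rename ρ).vars →
      (B.subst θ).vars ⊆ D.last.usedVars ∪ (C.rename ρ).vars := by
    intro B hB y hy
    obtain ⟨x, hx, hxy⟩ := Atom.mem_vars_subst.1 hy
    exact hθ x (hB hx) hxy
  refine ⟨fun s hs => ?_, fun x hx => ?_⟩
  · rcases List.mem_append.1 hs with hs | hs
    · obtain ⟨l, hl, rfl⟩ := List.mem_map.1 hs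
      rw [Literal.atom_subst]
      exact hatom _ fun x hx => Finset.mem_union_right _ (Clause.mem_vars.2 (.inr ⟨l, hl, hx⟩))
    · obtain ⟨t, ht, rfl⟩ := List.mem_map.1 hs
      simp only [Subgoal.subst, Literal.atom_subst]
      exact hatom _ ((h.1 t (by rw [sel]; exact List.mem_cons_of_mem _ ht)).trans
        Finset.subset_union_left)
  · rcases hx with hx | ⟨X, hX, hb⟩
    · exact Finset.mem_union_left _ (h.2 x hx)
    · exact hθ X (Finset.mem_union_left _ (h.2 X hX)) hb.2

theorem Derivation.VarsUsed.enterNeg {D : Derivation L} (h : D.VarsUsed) {A : Atom L}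
    {anc : Finset ℕ} {rest : List (Subgoal L)} (sel : D.last.goal = ⟨.neg A, anc⟩ :: rest) :
    (D.enterNeg A anc).VarsUsed := by
  refine ⟨fun s hs => ?_, h.2⟩
  obtain rfl := List.mem_singleton.1 hs
  exact h.1 ⟨.neg A, anc⟩ (by rw [sel]; exact List.mem_cons_self)

theorem Derivation.VarsUsed.solveNeg {D : Derivation L} (h : D.VarsUsed) : D.solveNeg.VarsUsed :=
  ⟨fun s hs => h.1 s (List.mem_of_mem_tail hs), h.2⟩

theorem Query.varsUsed_root (Q : Query L) (v : Fin Q.arity → ℕ) : (Q.root v).VarsUsed := by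
  refine ⟨fun s hs => ?_, fun x hx => ?_⟩
  · obtain rfl := List.mem_singleton.1 hs
    exact Finset.Subset.refl _
  · obtain ⟨i, hi, rfl⟩ := hx
    refine Atom.mem_vars.2 ⟨i, ?_⟩
    simp only [Query.rootAtom, hi]
    exact mem_varFinset_var.2 rfl

def Frame.derivation : Frame L → Derivation L
  | .expand D _ => D
  | .await D => D

/-- All derivations on the stack satisfy `Derivation.VarsUsed`. -/
def State.VarsUsed : State L → Prop
  | .run _ S => ∀ F ∈ S, F.derivation.VarsUsed
  | _ => True

theorem Step.varsUsed {P : Program L} {Q : Query L} {r : ℕ} {s s' : State L}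
    (h : Step P Q r s s') (hs : s.VarsUsed) : s'.VarsUsed := by
  cases h with
  | init v =>
    intro F hF
    obtain rfl := List.mem_singleton.1 hF
    exact Q.varsUsed_root v
  | finish => trivial
  | violate => trivial
  | success _ _ _ S =>
    exact fun F hF => hs F (List.mem_cons_of_mem _ ((afterSuccess_suffix S).subset hF))
  | exhausted => exact fun F hF => hs F (List.mem_cons_of_mem _ hF)
  | flounder => exact fun F hF => hs F (List.mem_cons_of_mem _ hF)
  | inapplicable =>
    obtain ⟨h1, h2⟩ := List.forall_mem_cons.1 hs
    exact List.forall_mem_cons.2 ⟨h1, h2⟩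
  | skip =>
    obtain ⟨h1, h2⟩ := List.forall_mem_cons.1 hs
    exact List.forall_mem_cons.2 ⟨h1, h2⟩
  | resolve _ _ _ _ _ _ _ _ sel _ _ _ _ mgu =>
    obtain ⟨h1, h2⟩ := List.forall_mem_cons.1 hs
    exact List.forall_mem_cons.2
      ⟨Derivation.VarsUsed.resolve h1 sel mgu.mgu, List.forall_mem_cons.2 ⟨h1, h2⟩⟩
  | enterNeg _ _ _ _ _ _ _ sel =>
    obtain ⟨h1, h2⟩ := List.forall_mem_cons.1 hs
    exact List.forall_mem_cons.2
      ⟨Derivation.VarsUsed.enterNeg h1 sel, List.forall_mem_cons.2 ⟨h1, h2⟩⟩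
  | solveNeg =>
    obtain ⟨h1, h2⟩ := List.forall_mem_cons.1 hs
    exact List.forall_mem_cons.2 ⟨Derivation.VarsUsed.solveNeg h1, h2⟩

theorem exists_step_start (P : Program L) (Q : Query L) (r : ℕ) :
    ∃ s, Step P Q r .start s := by
  let T : Finset ℕ := Finset.univ.biUnion fun j =>
    match Q.args j with
    | .inputMode => ∅
    | .term t => t.varFinset
  -- `T` holds the variables of the ordinary arguments. The chosen names lie above its maximum, and
  -- the offset `i` makes them distinct.
  refine ⟨_, .init (fun i => T.sup id + 1 + i) (fun i _ j _ h => ?_) fun i j t _ hj hmem => ?_⟩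
  · exact Fin.ext (Nat.add_left_cancel h)
  · have hT : T.sup id + 1 + i ∈ T := by
      refine Finset.mem_biUnion.2 ⟨j, Finset.mem_univ j, ?_⟩
      simpa only [hj] using hmem
    have := Finset.le_sup (f := id) hT
    simp only [id] at this
    omega

/-- The rules cover every shape of the top frame. Only resolution needs an object to be constructed:
applicability gives a renaming and some unifier, and since input variables have been used they avoid
the renamed clause, so a suitable mgu exists. -/
theorem exists_step_run {P : Program L} {Q : Query L} {r : ℕ} {flag : Bool}
    {S : List (Frame L)} (hS : (State.run flag S).VarsUsed) :
    ∃ s, Step P Q r (.run flag S) s := by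
  match S with
  | [] => exact ⟨_, .finish flag⟩
  | .await D :: S => exact ⟨_, .solveNeg flag D S⟩
  | .expand D todo :: S =>
    match sel : D.last.goal with
    | [] => exact ⟨_, .success flag D todo S sel⟩
    | ⟨.neg A, anc⟩ :: rest =>
      by_cases ground : A.vars = ∅
      · exact ⟨_, .enterNeg flag D todo S A anc rest sel ground⟩
      · exact ⟨_, .flounder flag D todo S A anc rest sel ground⟩
    | ⟨.pos A, anc⟩ :: rest =>
      match todo with
      | [] => exact ⟨_, .exhausted flag D S A anc rest sel⟩
      | C :: todo =>
        by_cases app : D.Applicable A C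
        · by_cases pre : ∃ g, D.IsLoopPrefix r C g
          · by_cases dec : ∀ g, D.IsLoopPrefix r C g → D.TermSizeDecrease r g
            · exact ⟨_, .skip flag D C todo S A anc rest sel app pre dec⟩
            · push Not at dec
              obtain ⟨g, hg, hdec⟩ := dec
              exact ⟨_, .violate flag D C todo S A anc rest sel app g hg hdec⟩
          · obtain ⟨ρ, apart, hU⟩ := app
            have hD : D.VarsUsed := hS _ List.mem_cons_self
            obtain ⟨θ, hθ⟩ := exists_isResolutionMgu (I := D.last.inputVars)
              (fun x hx hH => Finset.disjoint_right.1 apart.2 (hD.2 x hx)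
                (Clause.mem_vars.2 (.inl hH))) hU
            exact ⟨_, .resolve flag D C todo S A anc rest sel pre ρ apart θ hθ⟩
        · exact ⟨_, .inapplicable flag D C todo S A anc rest sel app⟩

theorem tpolpTerminates (P : Program L) (Q : Query L) (r : ℕ) : TPoLPTerminates P Q r := by
  refine ⟨fun ⟨run, h0, hrun⟩ => ?_, fun s hs hstuck => ?_⟩
  · exact (acc_iff_isEmpty_descending_chain.1 (acc_start P Q r)).false ⟨run, h0, hrun⟩
  · have hv : s.VarsUsed := by
      clear hstuck
      induction hs with
      | refl => trivial
      | tail _ hstep ih => exact hstep.varsUsed ih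
    match s with
    | .start => exact absurd (exists_step_start P Q r) hstuck
    | .run flag S => exact absurd (exists_step_run hv) hstuck
    | .halt a => exact ⟨a, rfl⟩

end LogicProg

theorem mainTheorem7 {L : FirstOrder.Language} (P : LogicProg.Program L)
    (Q₀ : LogicProg.Query L) (r : ℕ) (hr : 2 ≤ r) :
    LogicProg.TPoLPTerminates P Q₀ r :=
  LogicProg.tpolpTerminates P Q₀ r
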